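/- Let $A$ be a finite set with at least two elements, and let $F$ be the free group on $A$, its elements viewed as reduced words over $A\cup A^{-1}$. An $A$-generated group is a group $G$ with a (not necessarily injective) map $\varphi:A\to G$ whose image generates $G$; for $w\in F$ let $[w]_G$ be the value of $w$ in $G$. Morphisms of $A$-generated groups are group homomorphisms commuting with the maps from $A$; there is at most one from $H$ to $G$, it is then surjective, and its existence is written $H\twoheadrightarrow G$. The Cayley graph $\Gamma(G)$ has vertex set $G$ and, for each $g\in G$ and $x\in A\cup A^{-1}$, an edge $(g,x)$ from $g$ to $g[x]_G$ with inverse edge $(g[x]_G,x^{-1})$; subgraphs are closed under taking endpoints and inverse edges. A constellation of $\Gamma(G)$ is a triple $(\Xi,g,\Theta)$, where $\Xi,\Theta$ are connected subgraphs of $\Gamma(G)$ and $g\in G$, such that $1$ and $g$ are vertices of $\Xi\cap\Theta$ lying in distinct connected components of $\Xi\cap\Theta$. An $A$-generated group $H$ dissolves $(\Xi,g,\Theta)$ if $[u]_H\neq[v]_H$ for all $u,v\in F$ with $[u]_G=g=[v]_G$ such that the path in $\Gamma(G)$ starting at $1$ and labelled $u$ runs in $\Xi$ and the one labelled $v$ runs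 in $\Theta$. A dissolver of a finite $A$-generated group $G$ is a finite $A$-generated group $H$ with $H\twoheadrightarrow G$ that dissolves every constellation of $\Gamma(G)$. For a finite $A$-generated group $G$ and a prime $p$, let $R=\ker(F\to G)$ and let $R(C_p)$ be the intersection of all normal subgroups $N$ of $R$ for which $R/N$ is a finite direct power of the cyclic group of order $p$ (equivalently, $R(C_p)=R^p[R,R]$). The universal Gaschütz $p$-extension of $G$ is $G^{\mathbb{Z}/p}=F/R(C_p)$, and $G^{\widetilde{\mathbb{Z}/p}}=G^{\mathbb{Z}/p}/Z(G^{\mathbb{Z}/p})$ is its quotient by its centre; both are $A$-generated by the images of the letters. Theorem. Let $p,q,r$ be (not necessarily distinct) primes, let $G$ be a finite $A$-generated group, and let $H=(G^{\widetilde{\mathbb{Z}/p}})^{\widetilde{\mathbb{Z}/q}}$. Then $H^{\widetilde{\mathbb{Z}/r}}$ is a dissolver of $G$. -/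

import Mathlib

universe u v w

/-! ### Graphs with inverse edges -/

/-- A graph in which every edge `e` has an initial vertex `ι e`, a terminal vertex `τ e` and an
inverse edge `inv e ≠ e`. -/
structure InvGraph (V : Type u) (E : Type v) where
  ι : E → V
  τ : E → V
  inv : E → E
  inv_inv : ∀ e, inv (inv e) = e
  inv_ne : ∀ e, inv e ≠ e
  ι_inv : ∀ e, ι (inv e) = τ e

namespace InvGraph

variable {V : Type u} {E : Type v}

/-- `Γ.IsPath x es y`: the list of edges `es` is a path in `Γ` from `x` to `y` (the empty path at
each vertex being allowed). -/
def IsPath (Γ : InvGraph V E) : V → List E → V → Prop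
  | x, [], y => x = y
  | x, e :: es, y => Γ.ι e = x ∧ Γ.IsPath (Γ.τ e) es y

/-- A subgraph: sets of vertices and edges, closed under endpoints and inversion of edges. -/
structure Sub (Γ : InvGraph V E) where
  verts : Set V
  edges : Set E
  ι_mem : ∀ e ∈ edges, Γ.ι e ∈ verts
  τ_mem : ∀ e ∈ edges, Γ.τ e ∈ verts
  inv_mem : ∀ e ∈ edges, Γ.inv e ∈ edges

namespace Sub

variable {Γ : InvGraph V E}

/-- The intersection of two subgraphs. -/
def inter (Ξ Θ : Γ.Sub) : Γ.Sub where
  verts := Ξ.verts ∩ Θ.verts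
  edges := Ξ.edges ∩ Θ.edges
  ι_mem e he := ⟨Ξ.ι_mem e he.1, Θ.ι_mem e he.2⟩
  τ_mem e he := ⟨Ξ.τ_mem e he.1, Θ.τ_mem e he.2⟩
  inv_mem e he := ⟨Ξ.inv_mem e he.1, Θ.inv_mem e he.2⟩

/-- The path that starts at the vertex `x` and consists of the edges `es` runs entirely in the
subgraph `Δ`. -/
def Runs (Δ : Γ.Sub) (x : V) (es : List E) : Prop :=
  x ∈ Δ.verts ∧ ∀ e ∈ es, e ∈ Δ.edges

/-- `x` and `y` are joined by a path that runs in `Δ`, that is, they are vertices of `Δ` in the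
same connected component of `Δ`. -/
def Joined (Δ : Γ.Sub) (x y : V) : Prop :=
  ∃ es : List E, Γ.IsPath x es y ∧ Δ.Runs x es

/-- Any two vertices of the subgraph can be joined by a path in the subgraph. -/
def Connected (Δ : Γ.Sub) : Prop :=
  ∀ x ∈ Δ.verts, ∀ y ∈ Δ.verts, Δ.Joined x y

end Sub

/-- `(Ξ, g, Θ)` is a constellation in the graph `Γ` with distinguished vertex `o`. -/
structure IsConstellation (Γ : InvGraph V E) (o : V) (Ξ : Γ.Sub) (g : V) (Θ : Γ.Sub) : Prop where
  connected_left : Ξ.Connected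
  connected_right : Θ.Connected
  base_mem : o ∈ (Ξ.inter Θ).verts
  vertex_mem : g ∈ (Ξ.inter Θ).verts
  not_joined : ¬ (Ξ.inter Θ).Joined o g

end InvGraph

/-! ### `A`-generated groups -/

/-- An `A`-generated group: a group together with a (not necessarily injective) map from `A` onto
a generating family. -/
structure GenGroup (A : Type u) where
  carrier : Type v
  [group : Group carrier]
  gen : A → carrier
  closure_gen : Subgroup.closure (Set.range gen) = ⊤

namespace GenGroup

attribute [instance] GenGroup.group

variable {A : Type u}

/-- The value `[w]_G` of an element of the free group on `A` in the `A`-generated group `G`. -/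
def value (G : GenGroup.{u, v} A) : FreeGroup A →* G.carrier :=
  FreeGroup.lift G.gen

/-- The value of a letter; `(a, true)` is the letter `a` and `(a, false)` its formal inverse. -/
def letter (G : GenGroup.{u, v} A) (x : A × Bool) : G.carrier :=
  if x.2 then G.gen x.1 else (G.gen x.1)⁻¹

theorem letter_not (G : GenGroup.{u, v} A) (a : A) (b : Bool) :
    G.letter (a, !b) = (G.letter (a, b))⁻¹ := by
  cases b <;> simp [letter]

/-- The Cayley graph: the edge `(g, x)` goes from `g` to `g * x` and has label `x`. -/
def cayley (G : GenGroup.{u, v} A) : InvGraph G.carrier (G.carrier × (A × Bool)) where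
  ι e := e.1
  τ e := e.1 * G.letter e.2
  inv e := (e.1 * G.letter e.2, (e.2.1, !e.2.2))
  inv_inv := by
    rintro ⟨g, a, b⟩
    simp [letter_not]
  inv_ne := by
    rintro ⟨g, a, b⟩ h
    simpa using congrArg (fun e => e.2.2) h
  ι_inv _ := rfl

/-- The edges of the path in the Cayley graph that starts at `g` and is labeled by the given
word. -/
def wordPath (G : GenGroup.{u, v} A) : G.carrier → List (A × Bool) → List (G.carrier × (A × Bool))
  | _, [] => []
  | g, x :: l => (g, x) :: G.wordPath (g * G.letter x) l

/-- The `A`-generated group `H` dissolves the constellation `(Ξ, g, Θ)` of the Cayley graph of `G`;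
elements of the free group are read as reduced words. -/
def Dissolves [DecidableEq A] (H : GenGroup.{u, w} A) (G : GenGroup.{u, v} A)
    (Ξ : G.cayley.Sub) (g : G.carrier) (Θ : G.cayley.Sub) : Prop :=
  ∀ u v : FreeGroup A, G.value u = g → G.value v = g →
    Ξ.Runs 1 (G.wordPath 1 u.toWord) → Θ.Runs 1 (G.wordPath 1 v.toWord) →
    H.value u ≠ H.value v

/-- `H` is a finite `A`-generated group that dissolves every constellation of the Cayley graph
of `G`. -/
structure IsPredissolver [DecidableEq A] (H : GenGroup.{u, w} A) (G : GenGroup.{u, v} A) :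
    Prop where
  finite : Finite H.carrier
  dissolves : ∀ (Ξ : G.cayley.Sub) (g : G.carrier) (Θ : G.cayley.Sub),
    G.cayley.IsConstellation 1 Ξ g Θ → H.Dissolves G Ξ g Θ

/-- There is a morphism of `A`-generated groups from `H` to `G`; it is unique and surjective. -/
def MapsOnto (H : GenGroup.{u, w} A) (G : GenGroup.{u, v} A) : Prop :=
  ∃ χ : H.carrier →* G.carrier, ∀ a, χ (H.gen a) = G.gen a

/-- `H` is a dissolver of `G`: a predissolver that maps canonically onto `G`. -/
structure IsDissolver [DecidableEq A] (H : GenGroup.{u, w} A) (G : GenGroup.{u, v} A) : Prop where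
  predissolver : H.IsPredissolver G
  mapsOnto : H.MapsOnto G

end GenGroup

/-! ### The universal `S`-extension -/

/-- `R(S)`: the intersection of all normal subgroups `N` of `R` such that `R ⧸ N` is a finite power
of `S`. -/
def powerResidual (R : Type u) [Group R] (S : Type v) [Group S] : Subgroup R :=
  sInf {N : Subgroup R | ∃ _ : N.Normal, ∃ k : ℕ, Nonempty (R ⧸ N ≃* (Fin k → S))}

instance powerResidual_characteristic (R : Type u) [Group R] (S : Type v) [Group S] :
    (powerResidual R S).Characteristic := by
  rw [Subgroup.characteristic_iff_le_comap]
  intro φ x hx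
  rw [Subgroup.mem_comap, powerResidual, Subgroup.mem_sInf]
  rintro N ⟨hN, k, ⟨f⟩⟩
  have hx' := Subgroup.mem_sInf.1 hx (N.comap φ.toMonoidHom)
  refine Subgroup.mem_comap.1 (hx' ⟨inferInstance, k, ⟨?_⟩⟩)
  exact (QuotientGroup.congr (N.comap φ.toMonoidHom) N φ
    (Subgroup.map_comap_eq_self_of_surjective φ.surjective N)).trans f

namespace GenGroup

variable {A : Type u}

/-- The quotient of an `A`-generated group by a normal subgroup. -/
def quot (G : GenGroup.{u, v} A) (N : Subgroup G.carrier) [hN : N.Normal] : GenGroup.{u, v} A where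
  carrier := G.carrier ⧸ N
  gen a := (G.gen a : G.carrier ⧸ N)
  closure_gen := by
    have h : Set.range (fun a => (G.gen a : G.carrier ⧸ N))
        = QuotientGroup.mk' N '' Set.range G.gen := by
      rw [← Set.range_comp]; rfl
    rw [h, ← MonoidHom.map_closure, G.closure_gen, ← MonoidHom.range_eq_map]
    exact MonoidHom.range_eq_top.2 (QuotientGroup.mk'_surjective N)

/-- The free group on `A`, as an `A`-generated group. -/
def free (A : Type u) : GenGroup.{u, u} A where
  carrier := FreeGroup A
  gen := FreeGroup.of
  closure_gen := FreeGroup.closure_range_of A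

/-- `R(S)` as a subgroup of the free group `F` on `A`, where `R` is the kernel of `F → G`. -/
def relResidual (G : GenGroup.{u, v} A) (S : Type w) [Group S] : Subgroup (FreeGroup A) :=
  (powerResidual G.value.ker S).map G.value.ker.subtype

instance relResidual_normal (G : GenGroup.{u, v} A) (S : Type w) [Group S] :
    (G.relResidual S).Normal :=
  ConjAct.normal_of_characteristic_of_normal

/-- The `A`-universal `S`-extension `F / R(S)` of `G`, where `F` is the free group on `A` and `R` is
the kernel of `F → G`. -/
def univExt (G : GenGroup.{u, v} A) (S : Type w) [Group S] : GenGroup.{u, u} A where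
  carrier := FreeGroup A ⧸ G.relResidual S
  gen a := (FreeGroup.of a : FreeGroup A ⧸ G.relResidual S)
  closure_gen := ((free A).quot (N := G.relResidual S)
    (hN := G.relResidual_normal S)).closure_gen

/-- The universal Gaschütz `p`-extension: the universal extension for the cyclic group of
order `p`. -/
def gaschuetz (G : GenGroup.{u, v} A) (p : ℕ) : GenGroup.{u, u} A :=
  G.univExt (Multiplicative (ZMod p))

/-- The universal Gaschütz `p`-extension of `G` modulo its centre. -/
def gaschuetzModCenter (G : GenGroup.{u, v} A) (p : ℕ) : GenGroup.{u, u} A :=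
  (G.gaschuetz p).quot (Subgroup.center (G.gaschuetz p).carrier)

end GenGroup

/-! ### Kernels of maps to cyclic groups of prime order -/

/-! Words are compared through signed edge counts in Cayley graphs. At a fixed edge of Γ(G) the
count is a homomorphism from R to ℤ/p, so R(C_p) kills it. If s is trivial in G^{~p}, comparing the
counts of sx and xs for all x shows that s is closed in Γ(G) and that its count depends on the label
of the edge only (`value_and_count_of_value_gaschuetzModCenter`).

Put K₁ = G^{~p}, K = K₁^{~q}. Suppose u in Ξ and v in Θ end at g and agree in K^{~r}. Their counts
in Γ(K) modulo r differ by a constant for each label. Some constant is nonzero: otherwise the common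
support lies over Ξ ∩ Θ, and the indicator of the component of 1 there is a potential that cannot
drop between 1 and g (`exists_flow_ne`). For such a label, u or v uses the edge at every vertex of
K. So every element of ker(K → G) is the value of a closed path in Ξ or of one in Θ. These values
form submonoids, hence subgroups by finiteness, and a group is not the union of two proper
subgroups; say Ξ alone suffices.

But Ξ omits some edge e. By `exists_count_ne`, some closed path in Γ(K₁), after translation, has
different counts modulo q at two edges over e. A path in Ξ has count zero at both, and equality in K
would make the difference of the two counts constant. This contradiction shows that Ξ does not
suffice; Θ is excluded in the same way. -/

theorem mem_powerResidual_of_forall {R : Type u} [Group R] {S : Type v} [Group S] {x : R}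
    (h : ∀ (k : ℕ) (ψ : R →* (Fin k → S)), ψ x = 1) : x ∈ powerResidual R S := by
  rw [powerResidual, Subgroup.mem_sInf]
  rintro N ⟨hN, k, ⟨f⟩⟩
  have := h k (f.toMonoidHom.comp (QuotientGroup.mk' N))
  rw [← QuotientGroup.eq_one_iff]
  exact f.injective (by simpa using this)

/-- A nontrivial map to a group of prime order is onto, so its kernel is one of the subgroups being
intersected, with exponent 1. -/
theorem map_eq_one_of_mem_powerResidual {R : Type u} [Group R] {p : ℕ} (hp : p.Prime)
    {x : R} (hx : x ∈ powerResidual R (Multiplicative (ZMod p)))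
    (ψ : R →* Multiplicative (ZMod p)) : ψ x = 1 := by
  by_contra hne
  have : Fact p.Prime := ⟨hp⟩
  have hcard : Nat.card (Multiplicative (ZMod p)) = p := by simp
  have : Fact (Nat.card (Multiplicative (ZMod p))).Prime := ⟨by rw [hcard]; exact hp⟩
  have htop : ψ.range = ⊤ := by
    rcases Subgroup.eq_bot_or_eq_top_of_prime_card ψ.range with h | h
    · exact absurd (Subgroup.mem_bot.1 (h ▸ MonoidHom.mem_range.2 ⟨x, rfl⟩)) hne
    · exact h
  refine hne (MonoidHom.mem_ker.1 (Subgroup.mem_sInf.1 hx ψ.ker ⟨inferInstance, 1, ⟨?_⟩⟩))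
  exact (QuotientGroup.quotientKerEquivOfSurjective ψ (MonoidHom.range_eq_top.1 htop)).trans
    (MulEquiv.funUnique (Fin 1) (Multiplicative (ZMod p))).symm

/-! ### Values of words, morphisms and quotients of `A`-generated groups -/

namespace GenGroup

variable {A : Type u}

@[simp] theorem value_of (G : GenGroup.{u, v} A) (a : A) :
    G.value (FreeGroup.of a) = G.gen a := by simp [value]

theorem value_surjective (G : GenGroup.{u, v} A) : Function.Surjective G.value := by
  rw [← MonoidHom.range_eq_top, eq_top_iff, ← G.closure_gen, Subgroup.closure_le]
  rintro _ ⟨a, rfl⟩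
  exact ⟨FreeGroup.of a, G.value_of a⟩

theorem value_mk_cons (G : GenGroup.{u, v} A) (x : A × Bool) (L : List (A × Bool)) :
    G.value (FreeGroup.mk (x :: L)) = G.letter x * G.value (FreeGroup.mk L) := by
  obtain ⟨a, b⟩ := x
  cases b <;> simp [value, letter, FreeGroup.lift_mk]

theorem value_mk_nil (G : GenGroup.{u, v} A) : G.value (FreeGroup.mk []) = 1 := by
  simp [value, FreeGroup.lift_mk]

theorem value_mk_append (G : GenGroup.{u, v} A) (L L' : List (A × Bool)) :
    G.value (FreeGroup.mk (L ++ L')) =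
      G.value (FreeGroup.mk L) * G.value (FreeGroup.mk L') := by
  rw [← FreeGroup.mul_mk, map_mul]

theorem mapsOnto_of_ker_le {H : GenGroup.{u, w} A} {G : GenGroup.{u, v} A}
    (h : H.value.ker ≤ G.value.ker) : H.MapsOnto G := by
  refine ⟨(H.value.liftOfSurjective H.value_surjective) ⟨G.value, h⟩, fun a => ?_⟩
  have := MonoidHom.liftOfRightInverse_comp_apply H.value _
    (Function.rightInverse_surjInv H.value_surjective) ⟨G.value, h⟩ (FreeGroup.of a)
  simpa using this

theorem map_value {H : GenGroup.{u, w} A} {G : GenGroup.{u, v} A}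
    {χ : H.carrier →* G.carrier} (hχ : ∀ a, χ (H.gen a) = G.gen a) (w : FreeGroup A) :
    χ (H.value w) = G.value w := by
  have : χ.comp H.value = G.value := by
    ext a; simp [hχ]
  exact DFunLike.congr_fun this w

theorem value_quot (G : GenGroup.{u, v} A) (N : Subgroup G.carrier) [N.Normal]
    (w : FreeGroup A) : (G.quot N).value w = (QuotientGroup.mk' N) (G.value w) :=
  (map_value (H := G) (G := G.quot N) (χ := QuotientGroup.mk' N) (fun _ => rfl) w).symm

theorem value_univExt_eq_iff (G : GenGroup.{u, v} A) (S : Type w) [Group S]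
    (x y : FreeGroup A) :
    (G.univExt S).value x = (G.univExt S).value y ↔ x⁻¹ * y ∈ G.relResidual S := by
  have h : ∀ w, (G.univExt S).value w = QuotientGroup.mk' (G.relResidual S) w := by
    have : (G.univExt S).value = QuotientGroup.mk' (G.relResidual S) := by
      ext a; rw [value_of]; rfl
    intro w
    exact DFunLike.congr_fun this w
  rw [h, h]
  exact QuotientGroup.eq

theorem value_quot_eq_one_iff (G : GenGroup.{u, v} A) (N : Subgroup G.carrier) [N.Normal]
    (w : FreeGroup A) : (G.quot N).value w = 1 ↔ G.value w ∈ N := by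
  rw [value_quot]
  exact QuotientGroup.eq_one_iff _

/-- Centrality may be tested on words because F maps onto the extension. This form makes edge counts
applicable. -/
theorem value_gaschuetzModCenter_eq_one_iff (G : GenGroup.{u, v} A) (p : ℕ)
    (w : FreeGroup A) : (G.gaschuetzModCenter p).value w = 1 ↔
      ∀ x, (x * w)⁻¹ * (w * x) ∈ G.relResidual (Multiplicative (ZMod p)) := by
  rw [gaschuetzModCenter, value_quot_eq_one_iff, Subgroup.mem_center_iff,
    (G.gaschuetz p).value_surjective.forall]
  refine forall_congr' fun x => ?_
  rw [← map_mul, ← map_mul]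
  exact G.value_univExt_eq_iff _ _ _

theorem mem_relResidual_iff (G : GenGroup.{u, v} A) (S : Type w) [Group S] (w : FreeGroup A) :
    w ∈ G.relResidual S ↔ ∃ h : w ∈ G.value.ker, (⟨w, h⟩ : G.value.ker) ∈
      powerResidual G.value.ker S := by
  simp [relResidual]

theorem commutator_mem_relResidual (G : GenGroup.{u, v} A) (S : Type w) [CommGroup S]
    {x y : FreeGroup A} (hx : G.value x = 1) (hy : G.value y = 1) :
    (y * x)⁻¹ * (x * y) ∈ G.relResidual S := by
  rw [mem_relResidual_iff]
  refine ⟨by simp [MonoidHom.mem_ker, hx, hy], mem_powerResidual_of_forall fun k ψ => ?_⟩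
  have : ψ (((⟨y, hy⟩ : G.value.ker) * ⟨x, hx⟩)⁻¹ * (⟨x, hx⟩ * ⟨y, hy⟩)) = 1 := by
    simp only [map_mul, map_inv]
    rw [mul_comm (ψ ⟨x, hx⟩), inv_mul_cancel]
  exact this

/-! ### Finiteness -/

/-- R has finite index in a finitely generated group, so it is finitely generated; modulo R(C_p) it
becomes finitely generated abelian of exponent dividing p, hence finite. -/
instance finite_gaschuetz [Finite A] (G : GenGroup.{u, v} A) [Finite G.carrier] (p : ℕ)
    [hp : Fact p.Prime] : Finite (G.gaschuetz p).carrier := by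
  set R := G.value.ker with hR
  set P := powerResidual R (Multiplicative (ZMod p)) with hP
  have hRi : R.FiniteIndex := Subgroup.finiteIndex_ker G.value
  have hfg : Group.FG R := inferInstance
  have hcomm : ∀ a b : R ⧸ P, a * b = b * a := by
    intro a b
    obtain ⟨x, rfl⟩ := QuotientGroup.mk_surjective a
    obtain ⟨y, rfl⟩ := QuotientGroup.mk_surjective b
    rw [← QuotientGroup.mk_mul, ← QuotientGroup.mk_mul, QuotientGroup.eq]
    exact mem_powerResidual_of_forall fun k ψ => by
      simp only [map_mul, map_inv]
      rw [mul_comm (ψ y), inv_mul_cancel]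
  let _ : CommGroup (R ⧸ P) := { (inferInstance : Group (R ⧸ P)) with mul_comm := hcomm }
  have htor : IsMulTorsion (R ⧸ P) := by
    intro a
    obtain ⟨x, rfl⟩ := QuotientGroup.mk_surjective a
    refine isOfFinOrder_iff_pow_eq_one.2 ⟨p, hp.out.pos, ?_⟩
    rw [← QuotientGroup.mk_pow, QuotientGroup.eq_one_iff]
    refine mem_powerResidual_of_forall fun k ψ => ?_
    ext i
    rw [map_pow]
    change p • (Multiplicative.toAdd (ψ x i)) = 0
    simp
  have hfg' : Group.FG (R ⧸ P) := inferInstance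
  have hfin : Finite (R ⧸ P) := CommGroup.finite_of_fg_isMulTorsion _ htor
  have hPi : P.index ≠ 0 := Subgroup.index_ne_zero_of_finite
  have : (G.relResidual (Multiplicative (ZMod p))).FiniteIndex := by
    refine ⟨?_⟩
    rw [relResidual, Subgroup.index_map_subtype]
    exact mul_ne_zero hPi hRi.index_ne_zero
  exact Subgroup.finite_quotient_of_finiteIndex

instance finite_gaschuetzModCenter [Finite A] (G : GenGroup.{u, v} A) [Finite G.carrier]
    (p : ℕ) [Fact p.Prime] : Finite (G.gaschuetzModCenter p).carrier :=
  Quotient.finite _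

end GenGroup

namespace GenGroup

variable {A : Type u}

/-! ### Edge counts of paths in Cayley graphs -/

open Classical in
/-- The indicator function, with values in `k`, of the positive edge `(g, a)`. -/
noncomputable def edgeInd (G : GenGroup.{u, v} A) (k : Type w) [Ring k]
    (g : G.carrier) (a : A) (y : G.carrier) (b : A) : k :=
  if g = y ∧ a = b then 1 else 0

/-- The signed number of times that the path in the Cayley graph starting at `g` and labeled by a
word traverses the positive edge `(y, b)`. -/
noncomputable def flow (G : GenGroup.{u, v} A) (k : Type w) [Ring k] :
    G.carrier → List (A × Bool) → G.carrier → A → k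
  | _, [], _, _ => 0
  | g, (a, true) :: l, y, b => G.edgeInd k g a y b + flow G k (g * G.gen a) l y b
  | g, (a, false) :: l, y, b =>
      -- Reading a⁻¹ at g runs backwards along the positive edge that starts at g a⁻¹.
      flow G k (g * (G.gen a)⁻¹) l y b - G.edgeInd k (g * (G.gen a)⁻¹) a y b

variable (G : GenGroup.{u, v} A) (k : Type w) [Ring k]

theorem edgeInd_self (g : G.carrier) (a : A) : G.edgeInd k g a g a = 1 := by simp [edgeInd]

theorem edgeInd_of_ne_vertex {g y : G.carrier} (h : g ≠ y) (a b : A) :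
    G.edgeInd k g a y b = 0 := by simp [edgeInd, h]

theorem edgeInd_of_ne_letter {a b : A} (h : a ≠ b) (g y : G.carrier) :
    G.edgeInd k g a y b = 0 := by simp [edgeInd, h]

theorem edgeInd_mul_left (x g y : G.carrier) (a b : A) :
    G.edgeInd k (x * g) a y b = G.edgeInd k g a (x⁻¹ * y) b := by
  have : x * g = y ↔ g = x⁻¹ * y := eq_inv_mul_iff_mul_eq.symm
  unfold edgeInd
  congr 1
  rw [this]

theorem flow_append (L L' : List (A × Bool)) (g y : G.carrier) (b : A) :
    G.flow k g (L ++ L') y b =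
      G.flow k g L y b + G.flow k (g * G.value (FreeGroup.mk L)) L' y b := by
  induction L generalizing g with
  | nil => simp [flow, value_mk_nil]
  | cons x L ih =>
    obtain ⟨a, c⟩ := x
    cases c
    · simp only [List.cons_append, flow, ih, value_mk_cons, letter, mul_assoc]
      simp only [Bool.false_eq_true, if_false]
      abel
    · simp only [List.cons_append, flow, ih, value_mk_cons, letter, mul_assoc, if_true, add_assoc]

theorem flow_mul_left (L : List (A × Bool)) (x g y : G.carrier) (b : A) :
    G.flow k (x * g) L y b = G.flow k g L (x⁻¹ * y) b := by
  induction L generalizing g with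
  | nil => rfl
  | cons z L ih =>
    obtain ⟨a, c⟩ := z
    cases c <;> simp only [flow, mul_assoc, ih, edgeInd_mul_left]

/-- A cancelling pair runs along one edge forth and back, with total contribution zero. Hence counts
descend to the free group. -/
theorem flow_eq_of_step {L L' : List (A × Bool)} (h : FreeGroup.Red.Step L L')
    (g y : G.carrier) (b : A) : G.flow k g L y b = G.flow k g L' y b := by
  obtain ⟨⟩ := h
  rename_i L₁ L₂ a c
  rw [flow_append, flow_append]
  cases c <;> simp [flow]

/-- The signed number of times that the path in the Cayley graph starting at `1` and labeled by
an element of the free group traverses the positive edge `(y, b)`. -/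
noncomputable def count (x : FreeGroup A) (y : G.carrier) (b : A) : k :=
  Quot.lift (fun L => G.flow k 1 L y b) (fun _ _ h => G.flow_eq_of_step k h 1 y b) x

theorem count_mk (L : List (A × Bool)) (y : G.carrier) (b : A) :
    G.count k (FreeGroup.mk L) y b = G.flow k 1 L y b := rfl

theorem count_mul (x x' : FreeGroup A) (y : G.carrier) (b : A) :
    G.count k (x * x') y b = G.count k x y b + G.count k x' ((G.value x)⁻¹ * y) b := by
  induction x using Quot.inductionOn with | _ L
  induction x' using Quot.inductionOn with | _ L'
  change G.flow k 1 (L ++ L') y b = G.flow k 1 L y b +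
    G.flow k 1 L' ((G.value (FreeGroup.mk L))⁻¹ * y) b
  rw [flow_append, ← flow_mul_left, one_mul, mul_one]

@[simp] theorem count_one (y : G.carrier) (b : A) : G.count k 1 y b = 0 := rfl

theorem count_of (a : A) (y : G.carrier) (b : A) :
    G.count k (FreeGroup.of a) y b = G.edgeInd k 1 a y b := by
  change G.flow k 1 [(a, true)] y b = _
  simp [flow]

theorem count_inv (x : FreeGroup A) (y : G.carrier) (b : A) :
    G.count k x⁻¹ y b = - G.count k x (G.value x * y) b := by
  have := G.count_mul k x x⁻¹ (G.value x * y) b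
  rw [mul_inv_cancel, count_one, inv_mul_cancel_left] at this
  exact (neg_eq_of_add_eq_zero_right this.symm).symm

theorem count_conj (t : FreeGroup A) {x : FreeGroup A} (hx : G.value x = 1)
    (y : G.carrier) (b : A) :
    G.count k (t * x * t⁻¹) y b = G.count k x ((G.value t)⁻¹ * y) b := by
  rw [count_mul, count_mul, count_inv]
  simp [hx]

theorem count_pow_of_ne {a b : A} (h : a ≠ b) (i : ℕ) (y : G.carrier) :
    G.count k (FreeGroup.of a ^ i) y b = 0 := by
  induction i with
  | zero => rfl
  | succ i ih => rw [pow_succ, count_mul, ih, count_of, edgeInd_of_ne_letter _ _ h, add_zero]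

theorem count_pow_eq_zero {a : A} {i : ℕ} {y : G.carrier} (h : ∀ j < i, G.gen a ^ j ≠ y) (b : A) :
    G.count k (FreeGroup.of a ^ i) y b = 0 := by
  induction i with
  | zero => rfl
  | succ i ih =>
    rw [pow_succ, count_mul, ih fun j hj => h j (hj.trans i.lt_succ_self), count_of,
      edgeInd_of_ne_vertex, add_zero]
    intro h'
    refine h i i.lt_succ_self ?_
    rw [eq_inv_mul_iff_mul_eq, mul_one] at h'
    simpa using h'

theorem count_pow_one {a : A} {i : ℕ} (hi : 0 < i) (h : ∀ j < i, 0 < j → G.gen a ^ j ≠ 1) :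
    G.count k (FreeGroup.of a ^ i) 1 a = 1 := by
  obtain ⟨i, rfl⟩ := Nat.exists_eq_succ_of_ne_zero hi.ne'
  rw [pow_succ', count_mul, count_of, edgeInd_self, count_pow_eq_zero, add_zero]
  intro j hj h'
  rw [value_of, mul_one, eq_inv_iff_mul_eq_one, ← pow_succ] at h'
  exact h (j + 1) (Nat.succ_lt_succ hj) j.succ_pos h'

theorem count_pow_orderOf [Finite G.carrier] (a : A) :
    G.count k (FreeGroup.of a ^ orderOf (G.gen a)) 1 a = 1 :=
  G.count_pow_one k (orderOf_pos _) fun _ hj hj' => pow_ne_one_of_lt_orderOf hj'.ne' hj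

theorem exists_split_of_flow_ne_zero {L : List (A × Bool)} {g y : G.carrier} {a : A}
    (h : G.flow k g L y a ≠ 0) : ∃ (L₁ : List (A × Bool)) (c : Bool) (L₂ : List (A × Bool)),
      L = L₁ ++ (a, c) :: L₂ ∧ (c = true ∧ g * G.value (FreeGroup.mk L₁) = y ∨
        c = false ∧ g * G.value (FreeGroup.mk L₁) * (G.gen a)⁻¹ = y) := by
  induction L generalizing g with
  | nil => exact absurd rfl h
  | cons z L ih =>
    obtain ⟨b, c⟩ := z
    by_cases h' : G.flow k (g * G.letter (b, c)) L y a = 0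
    · refine ⟨[], c, L, ?_⟩
      cases c
      · simp only [letter, Bool.false_eq_true, if_false] at h'
        simp only [flow, h', edgeInd] at h
        simp only [value_mk_nil]
        split_ifs at h with h''
        · obtain ⟨rfl, rfl⟩ := h''
          simp
        · simp at h
      · simp only [letter, if_true] at h'
        simp only [flow, h', edgeInd] at h
        simp only [value_mk_nil]
        split_ifs at h with h''
        · simp [h''.1, h''.2]
        · simp at h
    · obtain ⟨L₁, d, L₂, rfl, hd⟩ := ih h'
      refine ⟨(b, c) :: L₁, d, L₂, rfl, ?_⟩
      simpa only [value_mk_cons, mul_assoc] using hd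

/-- The potential difference along a path is the sum of the potential differences of its edges. -/
theorem sum_flow_mul [Fintype G.carrier] [Fintype A] (φ : G.carrier → k)
    (L : List (A × Bool)) (g : G.carrier) :
    ∑ e : G.carrier × A, G.flow k g L e.1 e.2 * (φ (e.1 * G.gen e.2) - φ e.1) =
      φ (g * G.value (FreeGroup.mk L)) - φ g := by
  have hind : ∀ g a, ∑ e : G.carrier × A,
      G.edgeInd k g a e.1 e.2 * (φ (e.1 * G.gen e.2) - φ e.1) = φ (g * G.gen a) - φ g := by
    intro g a
    rw [Finset.sum_eq_single (g, a)]
    · simp [edgeInd_self]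
    · rintro ⟨y, b⟩ - hne
      have : G.edgeInd k g a y b = 0 := by
        simp only [edgeInd]
        rw [if_neg]
        rintro ⟨rfl, rfl⟩
        exact hne rfl
      simp [this]
    · simp
  induction L generalizing g with
  | nil => simp [flow, value_mk_nil]
  | cons z L ih =>
    obtain ⟨b, c⟩ := z
    cases c
    · simp only [flow, sub_mul, Finset.sum_sub_distrib, ih, hind, value_mk_cons, letter]
      simp [mul_assoc]
    · simp only [flow, add_mul, Finset.sum_add_distrib, ih, hind, value_mk_cons, letter]
      simp [mul_assoc]

/-! ### Edge counts and universal extensions -/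

variable {G}

/-- The translation in `count_mul` is trivial on R, so the count at a fixed edge is a homomorphism
from R to a group of order p. -/
theorem value_and_count_of_mem_relResidual {p : ℕ} (hp : p.Prime) {t : FreeGroup A}
    (ht : t ∈ G.relResidual (Multiplicative (ZMod p))) :
    G.value t = 1 ∧ ∀ y b, G.count (ZMod p) t y b = 0 := by
  obtain ⟨h, h'⟩ := (mem_relResidual_iff _ _ _).1 ht
  refine ⟨h, fun y b => ?_⟩
  let ψ : G.value.ker →* Multiplicative (ZMod p) :=
    { toFun := fun x => Multiplicative.ofAdd (G.count (ZMod p) x.1 y b)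
      map_one' := rfl
      map_mul' := fun x x' => by
        have hx : G.value x.1 = 1 := x.2
        simp [count_mul, hx] }
  exact map_eq_one_of_mem_powerResidual hp h' ψ

theorem value_eq_and_count_eq_of_inv_mul_mem_relResidual {p : ℕ} (hp : p.Prime)
    {x x' : FreeGroup A} (h : x⁻¹ * x' ∈ G.relResidual (Multiplicative (ZMod p))) :
    G.value x' = G.value x ∧ ∀ y b, G.count (ZMod p) x' y b = G.count (ZMod p) x y b := by
  obtain ⟨h1, h2⟩ := value_and_count_of_mem_relResidual hp h
  rw [map_mul, map_inv, inv_mul_eq_one] at h1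
  refine ⟨h1.symm, fun y b => ?_⟩
  rw [← mul_inv_cancel_left x x', count_mul, h2, add_zero]

theorem mem_powers_of_count_pow_ne_zero {a b : A} {i : ℕ} {y : G.carrier}
    (h : G.count k (FreeGroup.of a ^ i) y b ≠ 0) : ∃ j, G.gen a ^ j = y := by
  by_contra! h'
  exact h (count_pow_eq_zero _ _ (fun j _ => h' j) b)

/-- The action of a finite group with at least two formal generators on the cycles of its Cayley
graph is faithful. -/
theorem eq_one_of_count_invariant [Nontrivial A] [Finite G.carrier] [Nontrivial k] {h : G.carrier}
    (hh : ∀ x, G.value x = 1 → ∀ y b, G.count k x (h⁻¹ * y) b = G.count k x y b) : h = 1 := by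
  have hpow : ∀ a, ∃ j, G.gen a ^ j = h := by
    intro a
    -- The closed path a^ord(a) has count 1 at the edge (1, a), hence also at (h, a), and it visits
    -- only powers of a.
    refine mem_powers_of_count_pow_ne_zero k (b := a) (i := orderOf (G.gen a)) ?_
    have := hh (FreeGroup.of a ^ orderOf (G.gen a)) (by simp [pow_orderOf_eq_one]) h a
    rw [← this, inv_mul_cancel, count_pow_orderOf]
    exact one_ne_zero
  by_contra hne
  obtain ⟨a, b, hab⟩ := exists_pair_ne A
  obtain ⟨j, hj⟩ := hpow b
  classical
  have hi := Nat.find_spec (hpow a)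
  set i := Nat.find (hpow a) with hi'
  have hmin : ∀ m < i, G.gen a ^ m ≠ h := fun m hm => Nat.find_min (hpow a) hm
  have hi0 : 0 < i := by
    refine Nat.pos_of_ne_zero fun h0 => hne ?_
    rw [← hi, h0, pow_zero]
  -- With i minimal, this closed path leaves 1 along a once, but leaves h only by letters b⁻¹; its
  -- counts at (1, a) and (h, a) are 1 and 0.
  have hx : G.value (FreeGroup.of a ^ i * (FreeGroup.of b ^ j)⁻¹) = 1 := by
    simp [hi, hj]
  have h1 := hh _ hx h a
  rw [inv_mul_cancel, count_mul, count_mul, count_inv, count_inv,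
    count_pow_of_ne _ _ hab.symm, count_pow_of_ne _ _ hab.symm,
    count_pow_eq_zero _ _ hmin, count_pow_one _ _ hi0] at h1
  · simp at h1
  · intro m hm hm0 h1
    refine hmin (i - m) (by omega) ?_
    rw [← hi, ← Nat.sub_add_cancel hm.le, pow_add, h1, mul_one, Nat.add_sub_cancel]

/-- Elements of the kernel of the map to the Gaschütz extension modulo its centre label closed
paths that traverse all edges with the same label equally often. -/
theorem value_and_count_of_value_gaschuetzModCenter [Nontrivial A] [Finite G.carrier] {p : ℕ}
    (hp : p.Prime) {s : FreeGroup A} (hs : (G.gaschuetzModCenter p).value s = 1) :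
    G.value s = 1 ∧ ∀ y y' b, G.count (ZMod p) s y b = G.count (ZMod p) s y' b := by
  have : Fact p.Prime := ⟨hp⟩
  have key : ∀ x y b, G.count (ZMod p) s y b + G.count (ZMod p) x ((G.value s)⁻¹ * y) b =
      G.count (ZMod p) x y b + G.count (ZMod p) s ((G.value x)⁻¹ * y) b := by
    intro x y b
    rw [← count_mul, ← count_mul]
    exact (value_eq_and_count_eq_of_inv_mul_mem_relResidual hp
      ((value_gaschuetzModCenter_eq_one_iff _ _ _).1 hs x)).2 y b
  have h1 : G.value s = 1 := by
    -- For closed x, `key` says that translation by the value of s preserves the counts of x.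
    refine eq_one_of_count_invariant (ZMod p) fun x hx y b => ?_
    have := key x y b
    rw [hx, inv_one, one_mul, add_comm] at this
    exact add_right_cancel this
  refine ⟨h1, fun y y' b => ?_⟩
  obtain ⟨x, hx⟩ := G.value_surjective (y * y'⁻¹)
  have := key x y b
  rw [h1, hx, inv_one, one_mul, add_comm] at this
  simpa using add_left_cancel this

theorem gaschuetzModCenter_mapsOnto [Nontrivial A] [Finite G.carrier] {p : ℕ} (hp : p.Prime) :
    (G.gaschuetzModCenter p).MapsOnto G :=
  mapsOnto_of_ker_le fun _ hs => (value_and_count_of_value_gaschuetzModCenter hp hs).1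

end GenGroup

namespace GenGroup

variable {A : Type u}

/-! ### Kernels of the Gaschütz extension modulo its centre -/

theorem value_gaschuetzModCenter_of_mem {G : GenGroup.{u, v} A} {p : ℕ} {t : FreeGroup A}
    (ht : t ∈ G.relResidual (Multiplicative (ZMod p))) :
    (G.gaschuetzModCenter p).value t = 1 := by
  refine (value_quot_eq_one_iff _ _ _).2 ?_
  have : (G.gaschuetz p).value 1 = (G.gaschuetz p).value t :=
    (G.value_univExt_eq_iff _ _ _).2 (by simpa using ht)
  rw [← this, map_one]
  exact one_mem _

theorem gaschuetzModCenter_ker_comm {G : GenGroup.{u, v} A} {p : ℕ}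
    {χ : (G.gaschuetzModCenter p).carrier →* G.carrier}
    (hχ : ∀ a, χ ((G.gaschuetzModCenter p).gen a) = G.gen a)
    {x y : (G.gaschuetzModCenter p).carrier} (hx : x ∈ χ.ker) (hy : y ∈ χ.ker) :
    x * y = y * x := by
  obtain ⟨s, rfl⟩ := value_surjective _ x
  obtain ⟨t, rfl⟩ := value_surjective _ y
  rw [MonoidHom.mem_ker, map_value hχ] at hx hy
  have := value_gaschuetzModCenter_of_mem
    (commutator_mem_relResidual G (Multiplicative (ZMod p)) hx hy)
  rw [map_mul, map_inv, map_mul, map_mul, inv_mul_eq_one] at this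
  exact this.symm

/-- A kernel element is represented by a power of a lying in R. Every word is a power of a times an
element of R, and both factors commute with it modulo R(C_p). So it is central in the Gaschütz
extension and dies in the quotient. -/
theorem gaschuetzModCenter_ker_eq_bot {G : GenGroup.{u, v} A} {p : ℕ}
    {χ : (G.gaschuetzModCenter p).carrier →* G.carrier}
    (hχ : ∀ a, χ ((G.gaschuetzModCenter p).gen a) = G.gen a) {a : A}
    (ha : ∀ x, x ∈ Subgroup.zpowers ((G.gaschuetzModCenter p).gen a)) : χ.ker = ⊥ := by
  rw [eq_bot_iff]
  intro x hx
  obtain ⟨l, rfl⟩ := Subgroup.mem_zpowers_iff.1 (ha x)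
  rw [← value_of, ← map_zpow] at hx ⊢
  rw [MonoidHom.mem_ker, map_value hχ] at hx
  rw [Subgroup.mem_bot, value_gaschuetzModCenter_eq_one_iff]
  intro y
  obtain ⟨j, hj⟩ := Subgroup.mem_zpowers_iff.1 (ha ((G.gaschuetzModCenter p).value y))
  have hj' : G.value ((FreeGroup.of a ^ j)⁻¹ * y) = 1 := by
    rw [← map_value hχ, map_mul, ← hj]
    simp
  have := commutator_mem_relResidual G (Multiplicative (ZMod p)) hx hj'
  convert this using 1
  have : Commute (FreeGroup.of a ^ l) (FreeGroup.of a ^ j) := Commute.zpow_zpow_self _ _ _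
  have h2 := this.inv_right.eq
  simp only [mul_inv_rev, inv_inv, mul_assoc]
  congr 2
  rw [← mul_assoc (FreeGroup.of a ^ l), h2, mul_assoc, mul_inv_cancel_left]

/-- Otherwise every closed path in Γ(G) has counts depending on the label only. The path a^ord(a)
then forces b = a^j in G, and the closed path a^j b⁻¹ uses (1, b) but not (g, b). -/
theorem gaschuetzModCenter_ker_ne_bot [Nontrivial A] {G : GenGroup.{u, v} A} [Finite G.carrier]
    {p : ℕ} (hp : p.Prime) {χ : (G.gaschuetzModCenter p).carrier →* G.carrier}
    (hχ : ∀ a, χ ((G.gaschuetzModCenter p).gen a) = G.gen a) {g : G.carrier} (hg : g ≠ 1) :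
    χ.ker ≠ ⊥ := by
  intro hbot
  have : Fact p.Prime := ⟨hp⟩
  have hconst : ∀ x, G.value x = 1 → ∀ y y' b,
      G.count (ZMod p) x y b = G.count (ZMod p) x y' b := by
    intro x hx
    refine (value_and_count_of_value_gaschuetzModCenter hp ?_).2
    rw [← Subgroup.mem_bot, ← hbot, MonoidHom.mem_ker, map_value hχ, hx]
  obtain ⟨a, b, hab⟩ := exists_pair_ne A
  obtain ⟨j, hj⟩ : ∃ j, G.gen a ^ j = G.gen b := by
    refine mem_powers_of_count_pow_ne_zero (ZMod p) (b := a) (i := orderOf (G.gen a)) ?_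
    rw [hconst _ (by simp [pow_orderOf_eq_one]) _ 1, count_pow_orderOf]
    exact one_ne_zero
  have := hconst (FreeGroup.of a ^ j * (FreeGroup.of b)⁻¹) (by simp [hj]) 1 g b
  rw [count_mul, count_mul, count_pow_of_ne _ _ hab, count_pow_of_ne _ _ hab, count_inv,
    count_inv] at this
  simp only [map_pow, value_of, hj, mul_inv_cancel_left, count_of, edgeInd_self,
    edgeInd_of_ne_vertex _ _ hg.symm] at this
  simp at this

/-! ### Separating two edges by a closed path -/

/-- Let `M` be a nontrivial abelian normal subgroup of `K`, and suppose that `K` is not generated by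
the single letter `a`. Then some closed path in the Cayley graph of `K` does not traverse all the
edges with label `a` starting in one coset of `M` equally often. -/
theorem exists_count_ne [Nontrivial A] {K : GenGroup.{u, v} A} [Finite K.carrier]
    (k : Type w) [Ring k] [Nontrivial k]
    (M : Subgroup K.carrier) [hMn : M.Normal] (hM : M ≠ ⊥)
    (hcomm : ∀ x ∈ M, ∀ y ∈ M, x * y = y * x) (a : A)
    (hcyc : (∀ x, x ∈ Subgroup.zpowers (K.gen a)) → M = ⊥) :
    ∃ x z h, K.value x = 1 ∧ h ∈ M ∧ K.count k x z a ≠ K.count k x (z * h) a := by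
  -- `H` makes the a-counts of closed paths constant on cosets of M. The aim is to deduce that a
  -- generates K.
  by_contra! H
  obtain ⟨h₀, hh₀M, hh₀⟩ := M.ne_bot_iff_exists_ne_one.1 hM |>.elim
    fun x hx => show ∃ h₀ ∈ M, h₀ ≠ 1 from ⟨x.1, x.2, fun h => hx (Subtype.ext h)⟩
  obtain ⟨j, hj⟩ : ∃ j, K.gen a ^ j = h₀ := by
    refine mem_powers_of_count_pow_ne_zero k (b := a) (i := orderOf (K.gen a)) ?_
    have := H (FreeGroup.of a ^ orderOf (K.gen a)) 1 h₀ (by simp [pow_orderOf_eq_one]) hh₀M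
    rw [one_mul] at this
    rw [← this, count_pow_orderOf]
    exact one_ne_zero
  have hex : ∃ i, 0 < i ∧ K.gen a ^ i ∈ M :=
    ⟨orderOf (K.gen a), orderOf_pos _, by rw [pow_orderOf_eq_one]; exact one_mem _⟩
  obtain ⟨i, ⟨hi0, hiM⟩, hmin⟩ : ∃ i, (0 < i ∧ K.gen a ^ i ∈ M) ∧
      ∀ m < i, 0 < m → K.gen a ^ m ∉ M := by
    classical
    exact ⟨Nat.find hex, Nat.find_spec hex, fun m hm hm0 hmM =>
      Nat.find_min hex hm ⟨hm0, hmM⟩⟩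
  set h := K.gen a ^ i with hh
  have hh1 : h ≠ 1 := by
    intro h1
    have hmod : K.gen a ^ (j % i) = h₀ := by
      rw [← hj]
      conv_rhs => rw [← Nat.mod_add_div j i]
      rw [pow_add, pow_mul, ← hh, h1, one_pow, mul_one]
    rcases Nat.eq_zero_or_pos (j % i) with h0 | h0
    · rw [h0, pow_zero] at hmod
      exact hh₀ hmod.symm
    · exact hmin _ (Nat.mod_lt _ hi0) h0 (hmod ▸ hh₀M)
  set P := M ⊓ Subgroup.zpowers (K.gen a) with hP
  have hhP : h ∈ P := ⟨hiM, Subgroup.npow_mem_zpowers _ _⟩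
  -- A cocycle which, by `H`, depends only on the value of the word in K.
  let φ : K.carrier → FreeGroup A → k := fun z x => K.count k x z a - K.count k x (z * h) a
  have φ_mul : ∀ z x x', φ z (x * x') = φ z x + φ ((K.value x)⁻¹ * z) x' := by
    intro z x x'
    simp only [φ, count_mul, mul_assoc]
    abel
  have φ_one : ∀ z, φ z 1 = 0 := fun z => by simp [φ]
  have φ_congr : ∀ {x x'}, K.value x = K.value x' → ∀ z, φ z x = φ z x' := by
    intro x x' hx z
    have h1 : K.value (x * x'⁻¹) = 1 := by simp [hx]
    have h2 : φ z (x * x'⁻¹) = 0 := sub_eq_zero.2 (H _ _ _ h1 hiM)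
    have h3 := φ_mul z (x * x'⁻¹) x'
    rwa [h2, h1, inv_one, one_mul, zero_add, inv_mul_cancel_right] at h3
  have φ_letter : ∀ {b}, b ≠ a → ∀ z, φ z (FreeGroup.of b) = 0 := by
    intro b hb z
    simp only [φ, count_of, edgeInd_of_ne_letter _ _ hb, sub_zero]
  have φ_a : ∀ y, y ∉ P → φ y (FreeGroup.of a) = 0 := by
    intro y hy
    simp only [φ, count_of]
    rw [edgeInd_of_ne_vertex, edgeInd_of_ne_vertex, sub_zero]
    · intro h1
      exact hy ((Subgroup.mul_mem_cancel_right P hhP).1 (h1 ▸ P.one_mem))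
    · rintro rfl
      exact hy P.one_mem
  -- By minimality of i, the path a^i leaves a vertex of M only at its start.
  have count_ai : ∀ y ∈ M, K.count k (FreeGroup.of a ^ i) y a =
      K.count k (FreeGroup.of a) y a := by
    intro y hy
    rw [count_of]
    by_cases hy1 : y = 1
    · subst hy1
      rw [edgeInd_self, count_pow_one _ _ hi0]
      intro m hm hm0 hm1
      exact hmin m hm hm0 (hm1 ▸ M.one_mem)
    · rw [edgeInd_of_ne_vertex _ _ (Ne.symm hy1), count_pow_eq_zero]
      rintro m hm rfl
      rcases Nat.eq_zero_or_pos m with rfl | h0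
      · exact hy1 (pow_zero _)
      · exact hmin m hm h0 hy
  have φ_ai : ∀ y ∈ M, φ y (FreeGroup.of a ^ i) = φ y (FreeGroup.of a) := by
    intro y hy
    simp only [φ, count_ai y hy, count_ai _ (M.mul_mem hy hiM)]
  -- Read x letter by letter: for z in P only a letter a read at a vertex of P contributes, and
  -- there a may be replaced by a^i, which stays in P.
  have claim : ∀ x : FreeGroup A, ∃ l : ℤ, K.gen a ^ l ∈ P ∧
      ∀ z ∈ P, φ z x = φ z (FreeGroup.of a ^ l) := by
    intro x
    have hx : x ∈ Subgroup.closure (Set.range (FreeGroup.of : A → FreeGroup A)) := by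
      rw [FreeGroup.closure_range_of]; trivial
    induction hx using Subgroup.closure_induction_right with
    | one => exact ⟨0, by simp, fun z _ => by simp⟩
    | mul_right x _ y hy ih =>
      obtain ⟨b, rfl⟩ := hy
      by_cases hb : b = a
      · subst hb
        by_cases hxP : K.value x ∈ P
        · obtain ⟨l, hl⟩ := Subgroup.mem_zpowers_iff.1 hxP.2
          refine ⟨l + i, ?_, fun z hz => ?_⟩
          · rw [zpow_add, hl, zpow_natCast]
            exact P.mul_mem hxP hhP
          · rw [φ_congr (x := FreeGroup.of b ^ (l + (i : ℤ))) (x' := x * FreeGroup.of b ^ i),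
              φ_mul, φ_mul, φ_ai]
            · exact (P.mul_mem (P.inv_mem hxP) hz).1
            · simp [zpow_add, hl]
        · obtain ⟨l, hl, hl'⟩ := ih
          refine ⟨l, hl, fun z hz => ?_⟩
          rw [φ_mul, φ_a, add_zero, hl' z hz]
          rwa [Subgroup.mul_mem_cancel_right P hz, inv_mem_iff]
      · obtain ⟨l, hl, hl'⟩ := ih
        refine ⟨l, hl, fun z hz => ?_⟩
        rw [φ_mul, φ_letter hb, add_zero, hl' z hz]
    | mul_inv_cancel x _ y hy ih =>
      obtain ⟨b, rfl⟩ := hy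
      have hstep : ∀ z, φ z x = φ z (x * (FreeGroup.of b)⁻¹) +
          φ ((K.value (x * (FreeGroup.of b)⁻¹))⁻¹ * z) (FreeGroup.of b) := by
        intro z
        rw [← φ_mul, inv_mul_cancel_right]
      by_cases hb : b = a
      · subst hb
        by_cases hxP : K.value (x * (FreeGroup.of b)⁻¹) ∈ P
        · obtain ⟨l, hl⟩ := Subgroup.mem_zpowers_iff.1 hxP.2
          refine ⟨l, hl ▸ hxP, fun z _ => φ_congr ?_ z⟩
          rw [← hl]
          simp
        · obtain ⟨l, hl, hl'⟩ := ih
          refine ⟨l, hl, fun z hz => ?_⟩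
          rw [← hl' z hz, hstep, φ_a, add_zero]
          rwa [Subgroup.mul_mem_cancel_right P hz, inv_mem_iff]
      · obtain ⟨l, hl, hl'⟩ := ih
        refine ⟨l, hl, fun z hz => ?_⟩
        rw [← hl' z hz, hstep, φ_letter hb, add_zero]
  -- If x⁻¹hx = a^l, then a^i x and x a^l have the same value. At z = 1 the first has φ equal to 1;
  -- the second has 0 if x is not in ⟨a⟩, since its a^l part then stays in a coset disjoint from
  -- ⟨a⟩.
  have crossing : ∀ x, (∀ z ∈ P, φ z x = 0) →
      (K.value x)⁻¹ * h * K.value x ∈ Subgroup.zpowers (K.gen a) →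
      K.value x ∈ Subgroup.zpowers (K.gen a) := by
    intro x hx hconj
    by_contra hxa
    obtain ⟨l, hl⟩ := (isOfFinOrder_of_finite (K.gen a)).mem_powers_iff_mem_zpowers.2 hconj
    have h1 : φ 1 (FreeGroup.of a ^ i * x) = φ 1 (x * FreeGroup.of a ^ l) := by
      refine φ_congr ?_ 1
      simp only [map_mul, map_pow, value_of]
      simp only at hl
      rw [hl, ← hh]
      group
    have hz : ∀ y, y ∉ Subgroup.zpowers (K.gen a) →
        K.count k (FreeGroup.of a ^ l) y a = 0 := by
      intro y hy
      refine count_pow_eq_zero _ _ (fun m _ hm => hy ?_) a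
      rw [← hm]
      exact Subgroup.npow_mem_zpowers _ _
    have h2 : φ ((K.value x)⁻¹ * 1) (FreeGroup.of a ^ l) = 0 := by
      simp only [φ]
      rw [hz, hz, sub_zero]
      · rwa [Subgroup.mul_mem_cancel_right _ hhP.2, mul_one, inv_mem_iff]
      · rwa [mul_one, inv_mem_iff]
    have h3 : φ 1 (FreeGroup.of a ^ i) = 1 := by
      rw [φ_ai 1 M.one_mem]
      simp only [φ, count_of, edgeInd_self]
      rw [edgeInd_of_ne_vertex, sub_zero]
      rw [one_mul]
      exact hh1.symm
    rw [φ_mul, φ_mul, h2, h3, hx 1 P.one_mem, hx, add_zero, add_zero] at h1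
    · exact one_ne_zero h1
    · rw [mul_one, map_pow, value_of, ← hh]
      exact P.inv_mem hhP
  -- Correct x by the power of a from `claim` so that φ vanishes on P; as M is abelian, conjugation
  -- fixes h and `crossing` applies.
  have hMa : M ≤ Subgroup.zpowers (K.gen a) := by
    intro r hr
    obtain ⟨x, rfl⟩ := K.value_surjective r
    obtain ⟨l, hl, hl'⟩ := claim x
    have hv : K.value ((FreeGroup.of a ^ l)⁻¹ * x) = (K.gen a ^ l)⁻¹ * K.value x := by simp
    have hvM : (K.gen a ^ l)⁻¹ * K.value x ∈ M := M.mul_mem (M.inv_mem hl.1) hr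
    have := crossing ((FreeGroup.of a ^ l)⁻¹ * x) ?_ ?_
    · rw [hv] at this
      exact (Subgroup.mul_mem_cancel_left _ ((Subgroup.zpowers _).inv_mem hl.2)).1 this
    · intro z hz
      have hv' : (K.value (FreeGroup.of a ^ l)⁻¹)⁻¹ * z = K.gen a ^ l * z := by simp
      rw [φ_mul, hv', hl' _ (P.mul_mem hl hz), ← hv', ← φ_mul, inv_mul_cancel, φ_one]
    · rw [hv, mul_assoc, hcomm h hiM _ hvM, inv_mul_cancel_left]
      exact hhP.2
  refine hM (hcyc fun x => ?_)
  -- A letter b ≠ a has φ = 0 and conjugates h into M ≤ ⟨a⟩, so `crossing` puts it in ⟨a⟩.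
  have hgen : Subgroup.closure (Set.range K.gen) ≤ Subgroup.zpowers (K.gen a) := by
    rw [Subgroup.closure_le]
    rintro _ ⟨b, rfl⟩
    by_cases hb : b = a
    · subst hb
      exact Subgroup.mem_zpowers _
    · have := crossing (FreeGroup.of b) (fun z _ => φ_letter hb z) ?_
      · rwa [value_of] at this
      · refine hMa ?_
        have := hMn.conj_mem h hiM (K.value (FreeGroup.of b))⁻¹
        rwa [inv_inv] at this
  rw [K.closure_gen] at hgen
  exact hgen trivial

end GenGroup

/-! ### Connected components and constellations -/

namespace InvGraph

variable {V : Type u} {E : Type v} {Γ : InvGraph V E}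

theorem isPath_append {x y z : V} {es es' : List E} (h : Γ.IsPath x es y)
    (h' : Γ.IsPath y es' z) : Γ.IsPath x (es ++ es') z := by
  induction es generalizing x with
  | nil => exact (show x = y from h) ▸ h'
  | cons e es ih => exact ⟨h.1, ih h.2⟩

namespace Sub

theorem Joined.edge {Δ : Γ.Sub} {x : V} {e : E} (h : Δ.Joined x (Γ.ι e)) (he : e ∈ Δ.edges) :
    Δ.Joined x (Γ.τ e) := by
  obtain ⟨es, h1, h2, h3⟩ := h
  refine ⟨es ++ [e], isPath_append h1 ⟨rfl, rfl⟩, h2, fun f hf => ?_⟩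
  rcases List.mem_append.1 hf with hf | hf
  · exact h3 f hf
  · exact List.mem_singleton.1 hf ▸ he

theorem joined_τ_iff {Δ : Γ.Sub} {x : V} {e : E} (he : e ∈ Δ.edges) :
    Δ.Joined x (Γ.τ e) ↔ Δ.Joined x (Γ.ι e) := by
  refine ⟨fun h => ?_, fun h => h.edge he⟩
  have := Joined.edge (Γ.ι_inv e ▸ h) (Δ.inv_mem e he)
  rwa [← Γ.ι_inv, Γ.inv_inv] at this

end Sub

theorem IsConstellation.symm {o g : V} {Ξ Θ : Γ.Sub} (h : Γ.IsConstellation o Ξ g Θ) :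
    Γ.IsConstellation o Θ g Ξ where
  connected_left := h.connected_right
  connected_right := h.connected_left
  base_mem := h.base_mem.symm
  vertex_mem := h.vertex_mem.symm
  not_joined := fun ⟨es, h1, h2, h3⟩ =>
    h.not_joined ⟨es, h1, h2.symm, fun e he => (h3 e he).symm⟩

theorem IsConstellation.ne {o g : V} {Ξ Θ : Γ.Sub} (h : Γ.IsConstellation o Ξ g Θ) : g ≠ o := by
  rintro rfl
  exact h.not_joined ⟨[], rfl, h.base_mem, by simp⟩

/-- If Ξ had every edge, a path in Θ from o to g would run in Ξ ∩ Θ. -/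
theorem IsConstellation.exists_edge_notMem {o g : V} {Ξ Θ : Γ.Sub}
    (h : Γ.IsConstellation o Ξ g Θ) : ∃ e, e ∉ Ξ.edges := by
  by_contra! hall
  obtain ⟨es, h1, h2, h3⟩ := h.connected_right o h.base_mem.2 g h.vertex_mem.2
  exact h.not_joined ⟨es, h1, h.base_mem, fun e he => ⟨hall e, h3 e he⟩⟩

end InvGraph

/-- A subgroup of a finite group is not the union of two smaller submonoids. -/
theorem Subgroup.forall_mem_or_forall_mem_of_finite {K : Type u} [Group K] [Finite K]
    (N : Subgroup K) {U V : Submonoid K} (h : ∀ n ∈ N, n ∈ U ∨ n ∈ V) :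
    (∀ n ∈ N, n ∈ U) ∨ (∀ n ∈ N, n ∈ V) := by
  -- In a finite group an inverse is a nonnegative power, so submonoids are subgroups.
  have inv_mem : ∀ (W : Submonoid K) x, x ∈ W → x⁻¹ ∈ W := by
    intro W x hx
    obtain ⟨m, hm⟩ := (isOfFinOrder_of_finite x).mem_powers_iff_mem_zpowers.2
      (Subgroup.inv_mem _ (Subgroup.mem_zpowers x))
    exact hm ▸ W.pow_mem hx m
  by_contra! hcon
  obtain ⟨⟨x, hxN, hxU⟩, y, hyN, hyV⟩ := hcon
  have hxV := (h x hxN).resolve_left hxU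
  have hyU := (h y hyN).resolve_right hyV
  rcases h _ (N.mul_mem hxN hyN) with h' | h'
  · exact hxU (by simpa using U.mul_mem h' (inv_mem U y hyU))
  · exact hyV (by simpa using V.mul_mem (inv_mem V x hxV) h')

/-! ### Paths in subgraphs and the dissolving of constellations -/

namespace GenGroup

variable {A : Type u}

theorem wordPath_append (G : GenGroup.{u, v} A) (L L' : List (A × Bool)) (g : G.carrier) :
    G.wordPath g (L ++ L') =
      G.wordPath g L ++ G.wordPath (g * G.value (FreeGroup.mk L)) L' := by
  induction L generalizing g with
  | nil => simp [wordPath, value_mk_nil]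
  | cons x L ih => simp [wordPath, ih, value_mk_cons, mul_assoc]

theorem cayley_edge_false_mem_iff {G : GenGroup.{u, v} A} {Ξ : G.cayley.Sub} {g : G.carrier}
    {a : A} : (g, (a, false)) ∈ Ξ.edges ↔ (g * (G.gen a)⁻¹, (a, true)) ∈ Ξ.edges := by
  constructor <;> intro h
  · simpa [cayley, letter] using Ξ.inv_mem _ h
  · simpa [cayley, letter] using Ξ.inv_mem _ h

theorem exists_positive_edge_notMem {G : GenGroup.{u, v} A} {Ξ : G.cayley.Sub}
    (h : ∃ e, e ∉ Ξ.edges) : ∃ (x : G.carrier) (a : A), (x, (a, true)) ∉ Ξ.edges := by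
  obtain ⟨⟨g, a, c⟩, he⟩ := h
  cases c
  · exact ⟨_, a, fun h => he (cayley_edge_false_mem_iff.2 h)⟩
  · exact ⟨g, a, he⟩

section Map

variable {K : GenGroup.{u, w} A} {G : GenGroup.{u, v} A} {χ : K.carrier →* G.carrier}

/-- A used edge puts its initial vertex y on the path. If it is run backwards, y is reached only
after the letter, which then belongs to the prefix. -/
theorem exists_prefix_of_flow_ne_zero {k : Type*} [Ring k] {Ξ : G.cayley.Sub}
    {L : List (A × Bool)} (hL : Ξ.Runs 1 (G.wordPath 1 L)) {y : K.carrier} {a : A}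
    (h : K.flow k 1 L y a ≠ 0) :
    ∃ L₁, K.value (FreeGroup.mk L₁) = y ∧ Ξ.Runs 1 (G.wordPath 1 L₁) := by
  have hpre : ∀ {L₁ L₂}, L = L₁ ++ L₂ → Ξ.Runs 1 (G.wordPath 1 L₁) := by
    rintro L₁ L₂ rfl
    rw [wordPath_append] at hL
    exact ⟨hL.1, fun e he => hL.2 e (List.mem_append_left _ he)⟩
  obtain ⟨L₁, c, L₂, hsplit, ⟨rfl, hy⟩ | ⟨rfl, hy⟩⟩ := K.exists_split_of_flow_ne_zero k h
  · exact ⟨L₁, by simpa using hy, hpre hsplit⟩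
  · refine ⟨L₁ ++ [(a, false)], ?_, hpre (L₂ := L₂) (by simpa using hsplit)⟩
    rw [value_mk_append, value_mk_cons, value_mk_nil]
    simpa [letter] using hy

theorem edge_mem_of_flow_ne_zero (hχ : ∀ a, χ (K.gen a) = G.gen a) {k : Type*} [Ring k]
    {Ξ : G.cayley.Sub} {L : List (A × Bool)} (hL : Ξ.Runs 1 (G.wordPath 1 L)) {y : K.carrier}
    {a : A} (h : K.flow k 1 L y a ≠ 0) : (χ y, (a, true)) ∈ Ξ.edges := by
  obtain ⟨L₁, c, L₂, rfl, h'⟩ := K.exists_split_of_flow_ne_zero k h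
  have he : (G.value (FreeGroup.mk L₁), (a, c)) ∈ Ξ.edges := by
    refine hL.2 _ ?_
    rw [wordPath_append, one_mul]
    exact List.mem_append_right _ List.mem_cons_self
  rcases h' with ⟨rfl, rfl⟩ | ⟨rfl, rfl⟩
  · simpa [map_value hχ] using he
  · simpa [map_value hχ, hχ] using cayley_edge_false_mem_iff.1 he

/-- The elements of `K` that are values of words labelling closed paths at `1` in the subgraph `Ξ`
of the Cayley graph of `G`. -/
def closedPathValues (hχ : ∀ a, χ (K.gen a) = G.gen a) (Ξ : G.cayley.Sub)
    (h1 : 1 ∈ Ξ.verts) : Submonoid K.carrier where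
  carrier := {n | χ n = 1 ∧
    ∃ L, K.value (FreeGroup.mk L) = n ∧ Ξ.Runs 1 (G.wordPath 1 L)}
  one_mem' := ⟨map_one χ, [], K.value_mk_nil, h1, by simp [wordPath]⟩
  mul_mem' := by
    rintro _ _ ⟨hn, L, rfl, hL⟩ ⟨hm, L', rfl, hL'⟩
    refine ⟨by rw [map_mul, hn, hm, one_mul], L ++ L', value_mk_append _ _ _, h1, ?_⟩
    rw [map_value hχ] at hn
    rw [wordPath_append, hn, mul_one]
    intro e he
    rcases List.mem_append.1 he with he | he
    · exact hL.2 e he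
    · exact hL'.2 e he

end Map

/-- If the subgraph `Ξ` omits an edge, then the values of closed paths in `Ξ` do not exhaust the
kernel of the map from the second iterated extension. -/
theorem exists_mem_ker_notMem_closedPathValues [Finite A] [Nontrivial A] {G : GenGroup.{u, v} A}
    [Finite G.carrier] {p q : ℕ} (hp : p.Prime) (hq : q.Prime)
    {χ : ((G.gaschuetzModCenter p).gaschuetzModCenter q).carrier →* G.carrier}
    (hχ : ∀ a, χ (((G.gaschuetzModCenter p).gaschuetzModCenter q).gen a) = G.gen a)
    {g : G.carrier} (hg : g ≠ 1) {Ξ : G.cayley.Sub} (h1 : 1 ∈ Ξ.verts)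
    (hΞ : ∃ e, e ∉ Ξ.edges) : ∃ n ∈ χ.ker, n ∉ closedPathValues hχ Ξ h1 := by
  have : Fact p.Prime := ⟨hp⟩
  have : Fact q.Prime := ⟨hq⟩
  set K := G.gaschuetzModCenter p with hK
  obtain ⟨x, a, hxa⟩ := exists_positive_edge_notMem hΞ
  obtain ⟨χ₁, hχ₁⟩ : K.MapsOnto G := gaschuetzModCenter_mapsOnto hp
  obtain ⟨s, z, h, hs, hh, hne⟩ := exists_count_ne (K := K) (ZMod q) χ₁.ker
    (gaschuetzModCenter_ker_ne_bot hp hχ₁ hg)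
    (fun x hx y hy => gaschuetzModCenter_ker_comm hχ₁ hx hy) a
    (fun ha => gaschuetzModCenter_ker_eq_bot hχ₁ ha)
  obtain ⟨t₀, rfl⟩ := G.value_surjective x
  -- Translation by t carries z to a vertex over x, so the edges at z and z h move to edges over the
  -- omitted edge.
  obtain ⟨t, ht⟩ := K.value_surjective (K.value t₀ * z⁻¹)
  have hcount : ∀ y, K.count (ZMod q) (t * s * t⁻¹) (K.value t₀ * y) a =
      K.count (ZMod q) s (z * y) a := by
    intro y
    rw [count_conj _ _ _ hs, ht]
    simp [mul_assoc]
  have hst : K.value (t * s * t⁻¹) = 1 := by simp [hs]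
  refine ⟨(K.gaschuetzModCenter q).value (t * s * t⁻¹), ?_, ?_⟩
  · rw [MonoidHom.mem_ker, map_value hχ, ← map_value hχ₁, hst, map_one]
  rintro ⟨-, L, hL, hrun⟩
  have hdiff : (K.gaschuetzModCenter q).value ((FreeGroup.mk L)⁻¹ * (t * s * t⁻¹)) = 1 := by
    rw [map_mul, map_inv, hL, inv_mul_cancel]
  obtain ⟨-, hconst⟩ := value_and_count_of_value_gaschuetzModCenter hq hdiff
  have hzero : ∀ y, χ₁ y = G.value t₀ → K.count (ZMod q) (FreeGroup.mk L) y a = 0 := by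
    intro y hy
    by_contra hne
    exact hxa (hy ▸ edge_mem_of_flow_ne_zero hχ₁ hrun hne)
  have hval : ∀ y, χ₁ y = G.value t₀ → K.count (ZMod q) (t * s * t⁻¹) y a =
      K.count (ZMod q) ((FreeGroup.mk L)⁻¹ * (t * s * t⁻¹)) 1 a := by
    intro y hy
    rw [← mul_inv_cancel_left (FreeGroup.mk L) (t * s * t⁻¹), count_mul, hzero y hy, zero_add,
      mul_inv_cancel_left]
    exact hconst _ _ _
  refine hne ?_
  have hz := hcount 1
  rw [mul_one, mul_one] at hz
  rw [← hz, ← hcount, hval _ (map_value hχ₁ _), hval]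
  rw [map_mul, map_value hχ₁, MonoidHom.mem_ker.1 hh, mul_one]

/-- Two paths in the two halves of a constellation with the same end cannot have the same edge
counts in an extension. -/
theorem exists_flow_ne [Finite A] {K : GenGroup.{u, w} A} {G : GenGroup.{u, v} A}
    [Finite K.carrier] {χ : K.carrier →* G.carrier} (hχ : ∀ a, χ (K.gen a) = G.gen a)
    {k : Type*} [Ring k] [Nontrivial k] {Ξ Θ : G.cayley.Sub} {g : G.carrier}
    (hc : G.cayley.IsConstellation 1 Ξ g Θ) {L L' : List (A × Bool)}
    (hL : Ξ.Runs 1 (G.wordPath 1 L)) (hL' : Θ.Runs 1 (G.wordPath 1 L'))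
    (hg : G.value (FreeGroup.mk L) = g) :
    ∃ y a, K.flow k 1 L y a ≠ K.flow k 1 L' y a := by
  by_contra! heq
  classical
  have := Fintype.ofFinite A
  have := Fintype.ofFinite K.carrier
  -- The indicator of the component of 1 in Ξ ∩ Θ, pulled back to K: it is 1 at the start of L and 0
  -- at its end, yet constant along each edge with nonzero flow.
  let φ : K.carrier → k := fun y => if (Ξ.inter Θ).Joined 1 (χ y) then 1 else 0
  have hsum := K.sum_flow_mul k φ L 1
  rw [Finset.sum_eq_zero] at hsum
  · have h1 : φ 1 = 1 := if_pos (by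
      rw [map_one]
      exact ⟨[], rfl, hc.base_mem, by simp⟩)
    have h2 : φ (1 * K.value (FreeGroup.mk L)) = 0 := if_neg (by
      rw [one_mul, map_value hχ, hg]
      exact hc.not_joined)
    rw [h1, h2] at hsum
    simp at hsum
  · rintro ⟨y, a⟩ -
    by_cases h0 : K.flow k 1 L y a = 0
    · simp [h0]
    · have he : (χ y, (a, true)) ∈ (Ξ.inter Θ).edges :=
        ⟨edge_mem_of_flow_ne_zero hχ hL h0, edge_mem_of_flow_ne_zero hχ hL' (heq y a ▸ h0)⟩
      have hiff : (Ξ.inter Θ).Joined 1 (χ (y * K.gen a)) ↔ (Ξ.inter Θ).Joined 1 (χ y) := by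
        have := InvGraph.Sub.joined_τ_iff (x := 1) he
        simpa [cayley, letter, hχ] using this
      have : φ (y * K.gen a) = φ y := by simp only [φ, hiff]
      simp [this]

theorem isDissolver_gaschuetzModCenter [Finite A] [Nontrivial A] [DecidableEq A]
    (G : GenGroup.{u, v} A) [Finite G.carrier] {p q r : ℕ}
    (hp : p.Prime) (hq : q.Prime) (hr : r.Prime) :
    (((G.gaschuetzModCenter p).gaschuetzModCenter q).gaschuetzModCenter r).IsDissolver G := by
  have : Fact p.Prime := ⟨hp⟩
  have : Fact q.Prime := ⟨hq⟩
  have : Fact r.Prime := ⟨hr⟩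
  obtain ⟨χ₁, hχ₁⟩ := gaschuetzModCenter_mapsOnto (G := G) hp
  set K := (G.gaschuetzModCenter p).gaschuetzModCenter q with hK
  obtain ⟨χ₂, hχ₂⟩ : K.MapsOnto (G.gaschuetzModCenter p) := gaschuetzModCenter_mapsOnto hq
  obtain ⟨χ₃, hχ₃⟩ : (K.gaschuetzModCenter r).MapsOnto K := gaschuetzModCenter_mapsOnto hr
  have hχ : ∀ a, (χ₁.comp χ₂) (K.gen a) = G.gen a := fun a => by simp [hχ₁, hχ₂]
  refine ⟨⟨inferInstance, ?_⟩, (χ₁.comp χ₂).comp χ₃, fun a => ?_⟩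
  swap
  · rw [MonoidHom.comp_apply, hχ₃, hχ]
  intro Ξ g Θ hc x x' hx hx' hrun hrun' heq
  have hdiff : (K.gaschuetzModCenter r).value (x * x'⁻¹) = 1 := by
    rw [map_mul, map_inv, heq, mul_inv_cancel]
  obtain ⟨hval, hconst⟩ := value_and_count_of_value_gaschuetzModCenter hr hdiff
  have hsub : ∀ y a, K.count (ZMod r) x y a =
      K.count (ZMod r) (x * x'⁻¹) y a + K.count (ZMod r) x' y a := by
    intro y a
    conv_lhs => rw [← inv_mul_cancel_right x x', count_mul, hval, inv_one, one_mul]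
  have hcount : ∀ x y a, K.count (ZMod r) x y a = K.flow (ZMod r) 1 x.toWord y a := by
    intro x y a
    rw [← count_mk, FreeGroup.mk_toWord]
  obtain ⟨y, a, hne⟩ := exists_flow_ne (K := K) hχ (k := ZMod r) hc hrun hrun'
    (by rw [FreeGroup.mk_toWord, hx])
  -- The difference of the counts at label a is the same at all vertices and nonzero at y, so at
  -- each n one of the two paths has nonzero count.
  have hcover : ∀ n ∈ (χ₁.comp χ₂).ker, n ∈ closedPathValues hχ Ξ hc.base_mem.1 ∨
      n ∈ closedPathValues hχ Θ hc.base_mem.2 := by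
    intro n hn
    by_cases h0 : K.flow (ZMod r) 1 x.toWord n a = 0
    · refine Or.inr ⟨hn, exists_prefix_of_flow_ne_zero (a := a) (k := ZMod r) hrun' ?_⟩
      intro h0'
      refine hne ?_
      rw [← hcount, ← hcount, hsub, hconst y n, add_eq_right]
      have := hsub n a
      rwa [hcount x, hcount x', h0, h0', add_zero, eq_comm] at this
    · exact Or.inl ⟨hn, exists_prefix_of_flow_ne_zero hrun h0⟩
  rcases Subgroup.forall_mem_or_forall_mem_of_finite _ hcover with h | h
  · obtain ⟨n, hn, hn'⟩ := exists_mem_ker_notMem_closedPathValues hp hq hχ hc.ne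
      hc.base_mem.1 hc.exists_edge_notMem
    exact hn' (h n hn)
  · obtain ⟨n, hn, hn'⟩ := exists_mem_ker_notMem_closedPathValues hp hq hχ hc.ne
      hc.base_mem.2 hc.symm.exists_edge_notMem
    exact hn' (h n hn)

end GenGroup

theorem mainTheorem5 {A : Type u} [Finite A] [Nontrivial A] [DecidableEq A]
    (G : GenGroup.{u, v} A) [Finite G.carrier] (p q r : ℕ)
    (hp : p.Prime) (hq : q.Prime) (hr : r.Prime) :
    (((G.gaschuetzModCenter p).gaschuetzModCenter q).gaschuetzModCenter r).IsDissolver G := by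
  exact G.isDissolver_gaschuetzModCenter hp hq hr
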